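/- A \emph{2-colored graph} is a triple $H=(V,E_r,E_b)$ with $V$ a finite vertex set and $E_r,E_b\subseteq\binom{V}{2}$ its sets of red and blue edges, which need not be disjoint. A 2-colored graph $G$ \emph{contains} $H$ if there is an injection $V(H)\to V(G)$ that maps red edges of $H$ to red edges of $G$ and blue edges of $H$ to blue edges of $G$; otherwise $G$ is \emph{$H$-free}. $H$ is \emph{bipartite} if it contains no odd cycle of length at least $3$ all of whose edges have the same color. For $G$ on $n$ vertices put $h_n(G)=(|E_r(G)|+|E_b(G)|)/\binom{n}{2}$, let $\pi_n(H)$ be the maximum of $h_n(G)$ over all $H$-free 2-colored graphs $G$ on $n$ vertices, and let $\pi(H)=\lim_{n\to\infty}\pi_n(H)$ be the Tur\'an density of $H$. Let $H$ be a 2-colored graph with at least one edge. Then the limit $\pi(H)$ exists, and \begin{enumerate} \item if $H$ is not bipartite, then $\pi(H)\ge \frac32$; \item if $H$ is bipartite, then $\pi(H)\le \frac32$. \end{enumerate} -/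

import Mathlib

/-- A 2-edge-colored graph `(V, E_r, E_b)`: two simple graphs (red and blue edges) on the same
vertex set, not necessarily edge-disjoint. -/
structure TwoColoredGraph (V : Type*) where
  /-- the graph of red edges -/
  red : SimpleGraph V
  /-- the graph of blue edges -/
  blue : SimpleGraph V

namespace TwoColoredGraph

/-- `H` is (isomorphic to) a sub-graph of `G`: there is an injection of vertices under which
red edges go to red edges and blue edges go to blue edges. -/
def IsContained {V W : Type*} (H : TwoColoredGraph V) (G : TwoColoredGraph W) : Prop :=
  ∃ f : V ↪ W, (∀ u v, H.red.Adj u v → G.red.Adj (f u) (f v)) ∧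
    (∀ u v, H.blue.Adj u v → G.blue.Adj (f u) (f v))

/-- `H` contains no odd cycle all of whose edges have the same color. (Cycles of a simple graph
have length at least `3` by definition.) -/
def IsBipartite {V : Type*} (H : TwoColoredGraph V) : Prop :=
  (∀ (v : V) (c : H.red.Walk v v), c.IsCycle → ¬ Odd c.length) ∧
    (∀ (v : V) (c : H.blue.Walk v v), c.IsCycle → ¬ Odd c.length)

/-- The edge density `h_n(G) = (|E_r| + |E_b|) / (n choose 2)` of a graph on `n` vertices. -/
noncomputable def edgeDensity {V : Type*} (G : TwoColoredGraph V) : ℝ :=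
  ((G.red.edgeSet.ncard : ℝ) + (G.blue.edgeSet.ncard : ℝ)) / ((Nat.card V).choose 2 : ℝ)

/-- `π_n(H)`: the maximum of `h_n(G)` over the 2-colored graphs `G` on `n` vertices that do not
contain `H`. The set below is finite, and it contains the density `0` of the edgeless graph as
soon as `H` has an edge, so that the supremum is then a maximum. -/
noncomputable def turanDensityAt {V : Type*} (H : TwoColoredGraph V) (n : ℕ) : ℝ :=
  sSup {x : ℝ | ∃ G : TwoColoredGraph (Fin n), ¬ H.IsContained G ∧ G.edgeDensity = x}

/-- The Turán density `π(H) = lim_{n → ∞} π_n(H)`. -/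
noncomputable def turanDensity {V : Type*} (H : TwoColoredGraph V) : ℝ :=
  Filter.limUnder Filter.atTop H.turanDensityAt

end TwoColoredGraph

/-!
Lower bound: if the red (blue) graph of `H` is not 2-colorable, then `H` is not contained in the
2-colored graph whose red (blue) graph is a balanced complete bipartite graph and whose other
color class is complete, and the density of that graph is at least `3 / 2`.

Upper bound: if `G` has density larger than `3 / 2 + ε`, deleting vertices of small degree leaves
a graph on `n` vertices of minimum degree at least `(3 / 2 + ε) n`, both colors counted. Its
doubly colored edges form a simple graph of minimum degree at least `(1 / 2 + ε) n`, which by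
Erdős–Stone contains a complete tripartite graph with large parts. Split the latter into disjoint
triangles: on average a vertex of `G` sends `9 / 2` of the six possible colored edges to such a
triangle, so a positive proportion of the vertices sends at least five edges to many of the
triangles. A vertex with five colored edges to a doubly colored triangle forms with it a
`2 × 2` grid, in which vertices in different rows are joined in red and vertices in different
columns in blue. By pigeonhole many vertices do so in the same way with the same triangles, which
gives a blow-up of the grid. The latter contains `H` if it is large: put a vertex of `H` into the
cell given by its classes in the two bipartitions.
-/

section

variable {V : Type*} {G : SimpleGraph V}

theorem exists_isPath_even_length_iff
    (hG : ∀ (v : V) (c : G.Walk v v), c.IsCycle → ¬ Odd c.length) {u v : V} (p : G.Walk u v) :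
    ∃ q : G.Walk u v, q.IsPath ∧ (Even q.length ↔ Even p.length) := by
  classical
  induction p with
  | nil => exact ⟨.nil, .nil, Iff.rfl⟩
  | @cons u x v h p ih =>
    obtain ⟨q, hq, hpar⟩ := ih
    by_cases hu : u ∈ q.support
    · -- `u ⟶ x` closes the initial segment of `q` up to a cycle, or backtracks along its only edge
      have hodd : Odd (q.takeUntil u hu).length := by
        by_cases he : s(u, x) ∈ (q.takeUntil u hu).edges
        · rw [(hq.takeUntil hu).length_eq_one_of_mem_edges (by rwa [Sym2.eq_swap])]
          exact odd_one
        · have hc := hG u (.cons h (q.takeUntil u hu))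
            ((SimpleGraph.Walk.cons_isCycle_iff _ h).2 ⟨hq.takeUntil hu, he⟩)
          rwa [SimpleGraph.Walk.length_cons, Nat.not_odd_iff_even, Nat.even_add_one,
            Nat.not_even_iff_odd] at hc
      have hlen : (q.takeUntil u hu).length + (q.dropUntil u hu).length = q.length := by
        rw [← SimpleGraph.Walk.length_append, SimpleGraph.Walk.take_spec]
      refine ⟨q.dropUntil u hu, hq.dropUntil hu, ?_⟩
      rw [SimpleGraph.Walk.length_cons]
      grind
    · refine ⟨.cons h q, (SimpleGraph.Walk.cons_isPath_iff h q).2 ⟨hq, hu⟩, ?_⟩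
      simp only [SimpleGraph.Walk.length_cons, Nat.even_add_one, hpar]

theorem colorable_two_iff_forall_isCycle_not_odd :
    G.Colorable 2 ↔ ∀ (v : V) (c : G.Walk v v), c.IsCycle → ¬ Odd c.length := by
  rw [SimpleGraph.two_colorable_iff_forall_loop_even]
  refine ⟨fun h v c _ => Nat.not_odd_iff_even.2 (h v c), fun h v c => ?_⟩
  obtain ⟨q, hq, hpar⟩ := exists_isPath_even_length_iff h c
  simp [← hpar, (SimpleGraph.Walk.isPath_iff_nil.1 hq).eq_nil]

theorem colorable_turanGraph {n r : ℕ} (hr : 0 < r) : (SimpleGraph.turanGraph n r).Colorable r :=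
  ⟨.mk (fun v => ⟨v % r, Nat.mod_lt _ hr⟩) fun {u v} (h : (u : ℕ) % r ≠ v % r) =>
    by simpa using h⟩

theorem choose_two_le_two_mul_card_edgeFinset_turanGraph (n : ℕ) :
    n.choose 2 ≤ 2 * (SimpleGraph.turanGraph n 2).edgeFinset.card := by
  rw [SimpleGraph.card_edgeFinset_turanGraph, Nat.choose_two_right]
  obtain ⟨k, rfl | rfl⟩ := n.even_or_odd'
  · have h1 : (2 * k) ^ 2 = 4 * k ^ 2 := by ring
    have h2 : 2 * k * (2 * k - 1) ≤ 4 * k ^ 2 := by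
      calc 2 * k * (2 * k - 1) ≤ 2 * k * (2 * k) := by gcongr; omega
        _ = _ := by ring
    simp only [Nat.mul_mod_right, ne_eq, OfNat.ofNat_ne_zero, not_false_eq_true, zero_pow,
      tsub_zero, Nat.choose_zero_succ, add_zero]
    omega
  · have h1 : (2 * k + 1) ^ 2 - ((2 * k + 1) % 2) ^ 2 = 4 * (k ^ 2 + k) := by
      rw [show (2 * k + 1) % 2 = 1 by omega, Nat.sub_eq_iff_eq_add
        (Nat.pow_le_pow_left (by omega) 2)]
      ring
    have h2 : (2 * k + 1) * (2 * k + 1 - 1) = 4 * k ^ 2 + 2 * k := by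
      rw [Nat.add_sub_cancel]
      ring
    rw [h1, h2]
    omega

theorem card_edgeFinset_comap_succAbove_add_degree {n : ℕ} (K : SimpleGraph (Fin (n + 1)))
    [DecidableRel K.Adj] (v : Fin (n + 1)) :
    (K.comap v.succAbove).edgeFinset.card + K.degree v = K.edgeFinset.card := by
  classical
  have e : K.comap v.succAbove ≃g K.induce {v}ᶜ :=
    ⟨finSuccAboveEquiv v, Iff.rfl⟩
  have h := K.degree_le_card_edgeFinset v
  rw [e.card_edgeFinset_eq, K.card_edgeFinset_induce_compl_singleton,
    K.card_edgeFinset_deleteIncidenceSet, Nat.sub_add_cancel h]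

theorem sum_le_card_mul_add_card_filter_mul {ι : Type*} [Fintype ι] {g : ι → ℕ} {a b : ℕ}
    (hg : ∀ i, g i ≤ a + b) :
    ∑ i, g i ≤ Fintype.card ι * a + (Finset.univ.filter (a < g ·)).card * b := by
  calc ∑ i, g i ≤ ∑ i, (a + if a < g i then b else 0) := by
        refine Finset.sum_le_sum fun i _ => ?_
        have := hg i
        split_ifs <;> omega
    _ = _ := by
        rw [Finset.sum_add_distrib, ← Finset.sum_filter, Finset.sum_const, Finset.sum_const,
          Finset.card_univ, smul_eq_mul, smul_eq_mul]

end

namespace TwoColoredGraph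

open Filter Finset

section size

variable {V W X : Type*}

theorem isBipartite_iff_colorable_two {H : TwoColoredGraph V} :
    H.IsBipartite ↔ H.red.Colorable 2 ∧ H.blue.Colorable 2 := by
  rw [colorable_two_iff_forall_isCycle_not_odd, colorable_two_iff_forall_isCycle_not_odd,
    IsBipartite]

theorem IsContained.trans {F : TwoColoredGraph V} {G : TwoColoredGraph W} {K : TwoColoredGraph X}
    (hFG : F.IsContained G) (hGK : G.IsContained K) : F.IsContained K := by
  obtain ⟨f, hfr, hfb⟩ := hFG
  obtain ⟨g, hgr, hgb⟩ := hGK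
  exact ⟨f.trans g, fun _ _ h => hgr _ _ (hfr _ _ h), fun _ _ h => hgb _ _ (hfb _ _ h)⟩

/-- The number of edges of `G`, where a pair of vertices that is both red and blue counts twice. -/
noncomputable def size (G : TwoColoredGraph V) : ℕ :=
  G.red.edgeSet.ncard + G.blue.edgeSet.ncard

open scoped Classical in
/-- The degree of a vertex of `G`, where an edge that is both red and blue counts twice. -/
noncomputable def degree [Fintype V] (G : TwoColoredGraph V) (v : V) : ℕ :=
  G.red.degree v + G.blue.degree v

/-- The 2-colored graph obtained from a graph on `Fin (n + 1)` by deleting the vertex `v` and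
renumbering the others in increasing order, so that it is a graph on `Fin n`. -/
def deleteVertex {n : ℕ} (G : TwoColoredGraph (Fin (n + 1))) (v : Fin (n + 1)) :
    TwoColoredGraph (Fin n) :=
  ⟨G.red.comap v.succAbove, G.blue.comap v.succAbove⟩

theorem deleteVertex_isContained {n : ℕ} (G : TwoColoredGraph (Fin (n + 1))) (v : Fin (n + 1)) :
    (G.deleteVertex v).IsContained G :=
  ⟨v.succAboveEmb, fun _ _ h => h, fun _ _ h => h⟩

open scoped Classical in
theorem size_eq_card_edgeFinset_add [Fintype V] (G : TwoColoredGraph V) :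
    G.size = #G.red.edgeFinset + #G.blue.edgeFinset := by
  simp only [size, ← SimpleGraph.coe_edgeFinset, Set.ncard_coe_finset]

theorem edgeDensity_eq_size_div {n : ℕ} (G : TwoColoredGraph (Fin n)) :
    G.edgeDensity = G.size / n.choose 2 := by
  rw [edgeDensity, size, Nat.card_fin, Nat.cast_add]

theorem size_le_two_mul_choose_two {n : ℕ} (G : TwoColoredGraph (Fin n)) :
    G.size ≤ 2 * n.choose 2 := by
  classical
  have hr := G.red.card_edgeFinset_le_card_choose_two
  have hb := G.blue.card_edgeFinset_le_card_choose_two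
  rw [Fintype.card_fin] at hr hb
  rw [size_eq_card_edgeFinset_add]
  omega

theorem sum_degree_eq_two_mul_size [Fintype V] (G : TwoColoredGraph V) :
    ∑ v, G.degree v = 2 * G.size := by
  classical
  simp only [degree, sum_add_distrib, SimpleGraph.sum_degrees_eq_twice_card_edges,
    size_eq_card_edgeFinset_add, mul_add]

theorem size_deleteVertex_add_degree {n : ℕ} (G : TwoColoredGraph (Fin (n + 1)))
    (v : Fin (n + 1)) : (G.deleteVertex v).size + G.degree v = G.size := by
  classical
  rw [size_eq_card_edgeFinset_add, size_eq_card_edgeFinset_add, degree,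
    ← card_edgeFinset_comap_succAbove_add_degree G.red v,
    ← card_edgeFinset_comap_succAbove_add_degree G.blue v, add_add_add_comm]
  simp only [deleteVertex]
  congr!

theorem sum_size_deleteVertex {n : ℕ} (G : TwoColoredGraph (Fin (n + 1))) :
    ∑ v, ((G.deleteVertex v).size : ℝ) = (n - 1) * G.size := by
  have h : ∑ v, (G.deleteVertex v).size + 2 * G.size = (n + 1) * G.size := by
    rw [← sum_degree_eq_two_mul_size, ← sum_add_distrib]
    simp only [size_deleteVertex_add_degree, sum_const, card_univ, Fintype.card_fin, smul_eq_mul]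
  have h' : (∑ v, ((G.deleteVertex v).size : ℝ)) + 2 * G.size = (n + 1) * G.size := by
    exact_mod_cast h
  linarith

end size

section limit

variable {V : Type*} {H : TwoColoredGraph V}

theorem turanDensityAt_le {n : ℕ} {c : ℝ} (hc : 0 ≤ c)
    (h : ∀ G : TwoColoredGraph (Fin n), ¬ H.IsContained G → G.edgeDensity ≤ c) :
    H.turanDensityAt n ≤ c := by
  refine Real.sSup_le ?_ hc
  rintro _ ⟨G, hG, rfl⟩
  exact h G hG

theorem edgeDensity_le_turanDensityAt {n : ℕ} {G : TwoColoredGraph (Fin n)}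
    (hG : ¬ H.IsContained G) : G.edgeDensity ≤ H.turanDensityAt n := by
  refine le_csSup ⟨2, ?_⟩ ⟨G, hG, rfl⟩
  rintro _ ⟨G, -, rfl⟩
  rw [edgeDensity_eq_size_div]
  exact div_le_of_le_mul₀ (by positivity) (by norm_num) (mod_cast G.size_le_two_mul_choose_two)

theorem size_le_turanDensityAt_mul {n : ℕ} (hn : 2 ≤ n) {G : TwoColoredGraph (Fin n)}
    (hG : ¬ H.IsContained G) : G.size ≤ H.turanDensityAt n * n.choose 2 := by
  rw [← div_le_iff₀ (mod_cast Nat.choose_pos hn), ← edgeDensity_eq_size_div]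
  exact edgeDensity_le_turanDensityAt hG

variable (H)

theorem turanDensityAt_nonneg (n : ℕ) : 0 ≤ H.turanDensityAt n := by
  refine Real.sSup_nonneg ?_
  rintro _ ⟨G, -, rfl⟩
  rw [edgeDensity_eq_size_div]
  positivity

theorem turanDensityAt_succ_le {n : ℕ} (hn : 2 ≤ n) :
    H.turanDensityAt (n + 1) ≤ H.turanDensityAt n := by
  refine turanDensityAt_le (H.turanDensityAt_nonneg n) fun G hG => ?_
  have hn' : (0 : ℝ) < n - 1 := by
    have : (2 : ℝ) ≤ n := mod_cast hn
    linarith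
  have hsum : (n - 1) * (G.size : ℝ) ≤ (n + 1) * (H.turanDensityAt n * n.choose 2) := by
    calc (n - 1) * (G.size : ℝ) = ∑ v, ((G.deleteVertex v).size : ℝ) :=
          G.sum_size_deleteVertex.symm
      _ ≤ ∑ _v : Fin (n + 1), H.turanDensityAt n * n.choose 2 :=
          sum_le_sum fun v _ => size_le_turanDensityAt_mul hn fun h =>
            hG (h.trans (G.deleteVertex_isContained v))
      _ = _ := by simp
  rw [edgeDensity_eq_size_div, div_le_iff₀ (mod_cast Nat.choose_pos (by omega))]
  refine le_of_mul_le_mul_left (hsum.trans_eq ?_) hn'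
  rw [Nat.cast_choose_two, Nat.cast_choose_two]
  push_cast
  ring

theorem tendsto_turanDensityAt : Tendsto H.turanDensityAt atTop (nhds H.turanDensity) := by
  have hanti : AntitoneOn H.turanDensityAt (Set.Ici 2) :=
    antitoneOn_nat_Ici_of_succ_le fun _ => H.turanDensityAt_succ_le
  have hbdd : BddBelow (H.turanDensityAt '' Set.Ici 2) :=
    ⟨0, Set.forall_mem_image.2 fun n _ => H.turanDensityAt_nonneg n⟩
  exact tendsto_nhds_limUnder
    ⟨_, Real.tendsto_atTop_csInf_of_antitoneOn_bddBelow_nat_Ici hanti hbdd⟩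

end limit

section lowerBound

variable {V : Type*} {H : TwoColoredGraph V}

theorem three_halves_le_turanDensityAt_of_size_eq {n : ℕ} (hn : 2 ≤ n)
    {G : TwoColoredGraph (Fin n)} (hG : ¬ H.IsContained G)
    (hsize : G.size = #(SimpleGraph.turanGraph n 2).edgeFinset + n.choose 2) :
    3 / 2 ≤ H.turanDensityAt n := by
  refine le_trans ?_ (edgeDensity_le_turanDensityAt hG)
  have h : (n.choose 2 : ℝ) ≤ 2 * #(SimpleGraph.turanGraph n 2).edgeFinset :=
    mod_cast choose_two_le_two_mul_card_edgeFinset_turanGraph n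
  rw [edgeDensity_eq_size_div, le_div_iff₀ (mod_cast Nat.choose_pos hn), hsize]
  push_cast
  linarith

theorem three_halves_le_turanDensity (hH : ¬ H.IsBipartite) : 3 / 2 ≤ H.turanDensity := by
  classical
  refine ge_of_tendsto H.tendsto_turanDensityAt ?_
  filter_upwards [eventually_ge_atTop 2] with n hn
  have htop : #(⊤ : SimpleGraph (Fin n)).edgeFinset = n.choose 2 := by
    rw [SimpleGraph.card_edgeFinset_top_eq_card_choose_two, Fintype.card_fin]
  have hcol : (SimpleGraph.turanGraph n 2).Colorable 2 := colorable_turanGraph two_pos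
  rw [isBipartite_iff_colorable_two, not_and_or] at hH
  rcases hH with hr | hb
  · refine three_halves_le_turanDensityAt_of_size_eq hn (G := ⟨SimpleGraph.turanGraph n 2, ⊤⟩)
      (fun ⟨f, hf, _⟩ => hr (hcol.of_hom ⟨f, hf _ _⟩)) ?_
    rw [size_eq_card_edgeFinset_add, ← htop]
    congr!
  · refine three_halves_le_turanDensityAt_of_size_eq hn (G := ⟨⊤, SimpleGraph.turanGraph n 2⟩)
      (fun ⟨f, _, hf⟩ => hb (hcol.of_hom ⟨f, hf _ _⟩)) ?_
    rw [size_eq_card_edgeFinset_add, ← htop, add_comm]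
    congr!

end lowerBound

section minDegree

variable {V : Type*} {H : TwoColoredGraph V}

theorem size_le_of_forall_exists_degree_le {c : ℝ} (hc : 0 ≤ c) {N : ℕ}
    (hN : ∀ n ≥ N, ∀ G : TwoColoredGraph (Fin (n + 1)), ¬ H.IsContained G →
      ∃ v, (G.degree v : ℝ) ≤ c * n) {n : ℕ} (hn : N ≤ n)
    (G : TwoColoredGraph (Fin n)) (hG : ¬ H.IsContained G) :
    (G.size : ℝ) ≤ 2 * N.choose 2 + c * n.choose 2 := by
  induction n, hn using Nat.le_induction with
  | base =>
    have h : (G.size : ℝ) ≤ 2 * N.choose 2 := mod_cast G.size_le_two_mul_choose_two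
    exact h.trans (le_add_of_nonneg_right (by positivity))
  | succ n hn ih =>
    obtain ⟨v, hv⟩ := hN n hn G hG
    have hdel := ih (G.deleteVertex v) fun h => hG (h.trans (G.deleteVertex_isContained v))
    have hsucc : (n + 1).choose 2 = n + n.choose 2 := by
      rw [Nat.choose_succ_succ', Nat.choose_one_right]
    rw [← G.size_deleteVertex_add_degree v, hsucc]
    push_cast
    linarith

theorem turanDensity_le_of_eventually_exists_degree_le {c : ℝ} (hc : 0 ≤ c)
    (h : ∀ᶠ n : ℕ in atTop, ∀ G : TwoColoredGraph (Fin (n + 1)), ¬ H.IsContained G →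
      ∃ v, (G.degree v : ℝ) ≤ c * n) : H.turanDensity ≤ c := by
  obtain ⟨N, hN⟩ := eventually_atTop.1 h
  have hchoose : Tendsto (fun n : ℕ => (n.choose 2 : ℝ)) atTop atTop := by
    refine (tendsto_add_atTop_iff_nat 1).1
      (tendsto_atTop_mono (fun n => ?_) tendsto_natCast_atTop_atTop)
    exact_mod_cast (Nat.choose_one_right n).symm.le.trans (Nat.le_add_right _ _)
  have hlim : Tendsto (fun n : ℕ => c + 2 * N.choose 2 / (n.choose 2 : ℝ)) atTop (nhds c) := by
    simpa using (tendsto_const_nhds.div_atTop hchoose).const_add c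
  refine le_of_tendsto_of_tendsto H.tendsto_turanDensityAt hlim ?_
  filter_upwards [eventually_ge_atTop N, eventually_ge_atTop 2] with n hn hn2
  refine turanDensityAt_le (by positivity) fun G hG => ?_
  have hpos : (0 : ℝ) < n.choose 2 := mod_cast Nat.choose_pos hn2
  rw [edgeDensity_eq_size_div, div_le_iff₀ hpos, add_mul, div_mul_cancel₀ _ hpos.ne', add_comm]
  exact size_le_of_forall_exists_degree_le hc hN hn G hG

end minDegree

section grid

variable {V W T : Type*}

/-- The 2-colored graph whose vertices lie in the four cells of a `2 × 2` grid, `T` many in each: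
vertices in different rows (first coordinate) are joined in red, vertices in different columns
(second coordinate) in blue. Every bipartite 2-colored graph embeds into one of these. -/
def gridBlowup (T : Type*) : TwoColoredGraph (Bool × Bool × T) where
  red := (⊤ : SimpleGraph Bool).comap (·.1)
  blue := (⊤ : SimpleGraph Bool).comap (·.2.1)

theorem IsBipartite.isContained_gridBlowup {H : TwoColoredGraph V} (hH : H.IsBipartite) :
    H.IsContained (gridBlowup V) := by
  obtain ⟨hr, hb⟩ := isBipartite_iff_colorable_two.1 hH
  let r : H.red.Coloring Bool := hr.toColoring (by simp)
  let b : H.blue.Coloring Bool := hb.toColoring (by simp)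
  exact ⟨⟨fun v => (r v, b v, v), fun u v h => congrArg (·.2.2) h⟩,
    fun _ _ h => r.valid h, fun _ _ h => b.valid h⟩

theorem gridBlowup_isContained {G : TwoColoredGraph W} (φ : Bool → Bool → T ↪ W)
    (hr : ∀ b b' i i', G.red.Adj (φ false b i) (φ true b' i'))
    (hb : ∀ a a' i i', G.blue.Adj (φ a false i) (φ a' true i')) :
    (gridBlowup T).IsContained G := by
  have hred : ∀ p q, (gridBlowup T).red.Adj p q →
      G.red.Adj (φ p.1 p.2.1 p.2.2) (φ q.1 q.2.1 q.2.2) := by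
    rintro ⟨_ | _, b, i⟩ ⟨_ | _, b', i'⟩ h
    · exact absurd rfl h
    · exact hr ..
    · exact (hr ..).symm
    · exact absurd rfl h
  have hblue : ∀ p q, (gridBlowup T).blue.Adj p q →
      G.blue.Adj (φ p.1 p.2.1 p.2.2) (φ q.1 q.2.1 q.2.2) := by
    rintro ⟨a, _ | _, i⟩ ⟨a', _ | _, i'⟩ h
    · exact absurd rfl h
    · exact hb ..
    · exact (hb ..).symm
    · exact absurd rfl h
  refine ⟨⟨fun p => φ p.1 p.2.1 p.2.2, fun p q hpq => ?_⟩, hred, hblue⟩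
  have h1 : p.1 = q.1 := by_contra fun h => (hred p q h).ne hpq
  have h2 : p.2.1 = q.2.1 := by_contra fun h => (hblue p q h).ne hpq
  have h3 : p.2.2 = q.2.2 := (φ q.1 q.2.1).injective (by simpa only [h1, h2] using hpq)
  exact Prod.ext h1 (Prod.ext h2 h3)

end grid

section apex

variable {W ι : Type*} (G : TwoColoredGraph W)

open scoped Classical in
/-- The number of colors in which `u` and `v` are adjacent, so that weights sum to degrees. -/
noncomputable def weight (u v : W) : ℕ :=
  (if G.red.Adj u v then 1 else 0) + (if G.blue.Adj u v then 1 else 0)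

/-- The vertex `v` and the vertices of `x` occupy the four cells of a `2 × 2` grid, as far as the
edges at `v` are concerned: `x 0` lies in neither the row nor the column of `v`, `x 1` in its
column and `x 2` in its row. This extends a doubly colored triangle `x` to the grid whose blow-up
is `gridBlowup`. -/
def IsApex (v : W) (x : Fin 3 → W) : Prop :=
  G.red.Adj (x 0) v ∧ G.blue.Adj (x 0) v ∧ G.red.Adj (x 1) v ∧ G.blue.Adj (x 2) v

theorem weight_le_two (u v : W) : G.weight u v ≤ 2 := by
  unfold weight
  split_ifs <;> omega

theorem sum_weight_eq_degree [Fintype W] (u : W) : ∑ v, G.weight u v = G.degree u := by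
  simp only [weight, degree, sum_add_distrib, ← card_filter,
    ← SimpleGraph.card_neighborFinset_eq_degree, SimpleGraph.neighborFinset_eq_filter]

theorem sum_weight_triple_le (v : W) (x : Fin 3 → W) : ∑ i, G.weight (x i) v ≤ 6 :=
  sum_le_card_nsmul univ _ 2 fun i _ => G.weight_le_two (x i) v

theorem sum_sum_sum_weight [Fintype W] [Fintype ι] (x : ι → Fin 3 → W) :
    ∑ v, ∑ m, ∑ i, G.weight (x m i) v = ∑ m, ∑ i, G.degree (x m i) := by
  simp only [← sum_weight_eq_degree]
  rw [sum_comm]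
  exact sum_congr rfl fun m _ => sum_comm

variable {G}

theorem exists_isApex_of_four_lt_sum_weight {v : W} {x : Fin 3 → W}
    (h : 4 < ∑ i, G.weight (x i) v) : ∃ σ : Equiv.Perm (Fin 3), G.IsApex v (x ∘ σ) := by
  classical
  -- at most one of the six colored edges from `v` to the triangle is missing
  have key : ∀ r b : Fin 3 → Bool, 4 < ∑ i, ((if r i then 1 else 0) + if b i then 1 else 0) →
      ∃ σ : Equiv.Perm (Fin 3), r (σ 0) ∧ b (σ 0) ∧ r (σ 1) ∧ b (σ 2) := by
    decide
  simpa [weight, IsApex] using key (fun i => G.red.Adj (x i) v) (fun i => G.blue.Adj (x i) v)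
    (by simpa [weight] using h)

theorem exists_perm_forall_isApex [Fintype ι] {v : W} {x : ι → Fin 3 → W} {s : ℕ}
    (h : 4 * Fintype.card ι + 12 * s < ∑ m, ∑ i, G.weight (x m i) v) :
    ∃ (σ : Equiv.Perm (Fin 3)) (S : Finset ι), s ≤ #S ∧ ∀ m ∈ S, G.IsApex v (x m ∘ σ) := by
  classical
  set F : Finset ι := {m | 4 < ∑ i, G.weight (x m i) v}
  have hF : 6 * s ≤ #F := by
    have : ∑ m, ∑ i, G.weight (x m i) v ≤ Fintype.card ι * 4 + #F * 2 :=
      sum_le_card_mul_add_card_filter_mul fun m => G.sum_weight_triple_le v (x m)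
    omega
  choose! σ hσ using fun m (hm : m ∈ F) => exists_isApex_of_four_lt_sum_weight (mem_filter.1 hm).2
  obtain ⟨τ, -, hτ⟩ := exists_le_card_fiber_of_mul_le_card_of_maps_to
    (fun m _ => mem_univ (σ m)) univ_nonempty (n := s) (s := F) (by simpa [Fintype.card_perm])
  refine ⟨τ, _, hτ, fun m hm => ?_⟩
  obtain ⟨hmF, rfl⟩ := mem_filter.1 hm
  exact hσ m hmF

theorem card_le_eight_mul_card_filter_lt_sum_weight [Fintype W] [Fintype ι] [Nonempty ι]
    {x : ι → Fin 3 → W} {s : ℕ} (hs : 48 * s ≤ Fintype.card ι)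
    (hdeg : ∀ m i, 3 * Fintype.card W ≤ 2 * G.degree (x m i)) :
    Fintype.card W ≤
      8 * #{v | 4 * Fintype.card ι + 12 * s < ∑ m, ∑ i, G.weight (x m i) v} := by
  set c := #{v | 4 * Fintype.card ι + 12 * s < ∑ m, ∑ i, G.weight (x m i) v}
  have hupper : ∑ v, ∑ m, ∑ i, G.weight (x m i) v ≤
      Fintype.card W * (4 * Fintype.card ι + 12 * s) + c * (2 * Fintype.card ι) := by
    refine sum_le_card_mul_add_card_filter_mul fun v => ?_
    have := sum_le_card_nsmul univ _ 6 fun m _ => G.sum_weight_triple_le v (x m)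
    rw [card_univ, smul_eq_mul] at this
    omega
  have hlower : 9 * Fintype.card ι * Fintype.card W ≤ 2 * ∑ v, ∑ m, ∑ i, G.weight (x m i) v := by
    calc 9 * Fintype.card ι * Fintype.card W = ∑ _m : ι, ∑ _i : Fin 3, 3 * Fintype.card W := by
          simp only [sum_const, card_univ, Fintype.card_fin, smul_eq_mul]
          ring
      _ ≤ ∑ m, ∑ i, 2 * G.degree (x m i) := sum_le_sum fun m _ => sum_le_sum fun i _ => hdeg m i
      _ = _ := by simp only [← mul_sum, sum_sum_sum_weight]
  -- Per triangle, the average `9 / 2` exceeds the threshold `4 + 12 / 48` by `1 / 4`, while no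
  -- vertex exceeds `4` by more than `2`.
  refine le_of_mul_le_mul_left ?_ (Fintype.card_pos : 0 < Fintype.card ι)
  nlinarith [Nat.mul_le_mul_right (Fintype.card W) hs]

theorem exists_perm_le_card_forall_isApex [Fintype W] [Fintype ι] {x : ι → Fin 3 → W} {s : ℕ}
    (hs0 : 0 < s) (hs : 48 * s ≤ Fintype.card ι)
    (hW : 48 * 2 ^ Fintype.card ι * s ≤ Fintype.card W)
    (hdeg : ∀ m i, 3 * Fintype.card W ≤ 2 * G.degree (x m i)) :
    ∃ (σ : Equiv.Perm (Fin 3)) (S : Finset ι) (A : Finset W), s ≤ #S ∧ s ≤ #A ∧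
      ∀ v ∈ A, ∀ m ∈ S, G.IsApex v (x m ∘ σ) := by
  classical
  have : Nonempty ι := Fintype.card_pos_iff.1 (by omega)
  set A : Finset W := {v | 4 * Fintype.card ι + 12 * s < ∑ m, ∑ i, G.weight (x m i) v}
  have hA : Fintype.card W ≤ 8 * #A := card_le_eight_mul_card_filter_lt_sum_weight hs hdeg
  choose! σ S hS hapex using
    fun v (hv : v ∈ A) => exists_perm_forall_isApex (mem_filter.1 hv).2
  have hcard : #(univ : Finset (Equiv.Perm (Fin 3) × Finset ι)) * s ≤ #A := by
    have hperm : Fintype.card (Equiv.Perm (Fin 3)) = 6 := by rw [Fintype.card_perm]; rfl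
    rw [card_univ, Fintype.card_prod, Fintype.card_finset, hperm]
    linarith
  obtain ⟨⟨τ, T⟩, -, hT⟩ := exists_le_card_fiber_of_mul_le_card_of_maps_to
    (f := fun v => (σ v, S v)) (fun v _ => mem_univ _) univ_nonempty hcard
  obtain ⟨v, hv⟩ := card_pos.1 (hs0.trans_le hT)
  simp only [mem_filter, Prod.mk.injEq] at hv
  refine ⟨τ, T, _, hv.2.2 ▸ hS v hv.1, hT, fun u hu => ?_⟩
  simp only [mem_filter, Prod.mk.injEq] at hu
  exact hu.2.1 ▸ hu.2.2 ▸ hapex u hu.1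

end apex

section upperBound

variable {V W T : Type*}

theorem degree_le_degree_inf_add_card [Fintype W] (G : TwoColoredGraph W) (v : W)
    [DecidableRel (G.red ⊓ G.blue).Adj] :
    G.degree v ≤ (G.red ⊓ G.blue).degree v + Fintype.card W := by
  classical
  have hinter : (G.red ⊓ G.blue).neighborFinset v =
      G.red.neighborFinset v ∩ G.blue.neighborFinset v := by
    ext
    simp
  rw [← (G.red ⊓ G.blue).card_neighborFinset_eq_degree v, hinter, degree,
    ← SimpleGraph.card_neighborFinset_eq_degree, ← SimpleGraph.card_neighborFinset_eq_degree,
    ← card_union_add_card_inter, add_comm]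
  gcongr
  exact card_le_univ _

theorem gridBlowup_isContained_of_completeEquipartiteGraph [Fintype W] [Fintype T]
    {G : TwoColoredGraph W} {s t : ℕ} (hT : Fintype.card T ≤ s) (hs : 0 < s) (ht : 48 * s ≤ t)
    (hW : 48 * 2 ^ t * s ≤ Fintype.card W)
    (hdeg : ∀ v, 3 * Fintype.card W ≤ 2 * G.degree v)
    (hG : (SimpleGraph.completeEquipartiteGraph 3 t).IsContained (G.red ⊓ G.blue)) :
    (gridBlowup T).IsContained G := by
  obtain ⟨f⟩ := hG
  obtain ⟨σ, S, A, hS, hA, hapex⟩ := exists_perm_le_card_forall_isApex (G := G)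
    (x := fun (m : Fin t) i => f (i, m)) hs (by simpa using ht) (by simpa using hW)
    fun _ _ => hdeg _
  obtain ⟨e⟩ : Nonempty (T ↪ S) :=
    Function.Embedding.nonempty_of_card_le (by rw [Fintype.card_coe]; omega)
  obtain ⟨a⟩ : Nonempty (T ↪ A) :=
    Function.Embedding.nonempty_of_card_le (by rw [Fintype.card_coe]; omega)
  let side (j : Fin 3) : T ↪ W :=
    ⟨fun i => f (σ j, e i), fun i i' h => by simpa using f.injective h⟩
  have hside : ∀ j k i i', j ≠ k → (G.red ⊓ G.blue).Adj (side j i) (side k i') :=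
    fun j k i i' hjk => f.toHom.map_adj (by simpa using hjk)
  have hapex' : ∀ i i', G.IsApex (a i) fun j => side j i' :=
    fun i i' => hapex _ (a i).2 _ (e i').2
  refine gridBlowup_isContained (fun
    | true, true => a.trans (.subtype _)
    | false, false => side 0
    | false, true => side 1
    | true, false => side 2) ?_ ?_
  · rintro (_ | _) (_ | _) i i'
    · exact (hside 0 2 i i' (by decide)).1
    · exact (hapex' i' i).1
    · exact (hside 1 2 i i' (by decide)).1
    · exact (hapex' i' i).2.2.1
  · rintro (_ | _) (_ | _) i i'
    · exact (hside 0 1 i i' (by decide)).2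
    · exact (hapex' i' i).2.1
    · exact (hside 2 1 i i' (by decide)).2
    · exact (hapex' i' i).2.2.2

theorem eventually_gridBlowup_isContained [Finite T] {ε : ℝ} (hε : 0 < ε) :
    ∀ᶠ n : ℕ in atTop, ∀ G : TwoColoredGraph (Fin n),
      (∀ v, (3 / 2 + ε) * n ≤ G.degree v) → (gridBlowup T).IsContained G := by
  classical
  have := Fintype.ofFinite T
  set s := Fintype.card T + 1
  filter_upwards [SimpleGraph.eventually_completeEquipartiteGraph_isContained_of_minDegree
    hε 2 (48 * s), eventually_ge_atTop (48 * 2 ^ (48 * s) * s), eventually_ge_atTop 1]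
    with n hES hn hn1 G hdeg
  have : Nonempty (Fin n) := ⟨⟨0, hn1⟩⟩
  refine gridBlowup_isContained_of_completeEquipartiteGraph (s := s) (by omega) (by omega) le_rfl
    (by simpa using hn) (fun v => ?_) (hES ?_)
  · have h : (3 : ℝ) * n ≤ 2 * G.degree v := by
      linarith [hdeg v, mul_nonneg hε.le n.cast_nonneg]
    rw [Fintype.card_fin]
    exact_mod_cast h
  · obtain ⟨v, hv⟩ := (G.red ⊓ G.blue).exists_minimal_degree_vertex
    have h : (G.degree v : ℝ) ≤ (G.red ⊓ G.blue).degree v + n := by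
      exact_mod_cast (G.degree_le_degree_inf_add_card v).trans_eq (by rw [Fintype.card_fin])
    rw [hv]
    push_cast
    linarith [hdeg v]

theorem IsBipartite.turanDensity_le [Finite V] {H : TwoColoredGraph V} (hH : H.IsBipartite) :
    H.turanDensity ≤ 3 / 2 := by
  refine le_of_forall_pos_le_add fun ε hε =>
    turanDensity_le_of_eventually_exists_degree_le (by positivity) ?_
  have hgrid := (tendsto_add_atTop_nat 1).eventually
    (eventually_gridBlowup_isContained (T := V) (half_pos hε))
  have hlarge := tendsto_natCast_atTop_atTop.eventually_ge_atTop ((3 / 2 + ε / 2) / (ε / 2))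
  filter_upwards [hgrid, hlarge] with n hgrid hlarge G hG
  by_contra! hdeg
  refine hG (hH.isContained_gridBlowup.trans (hgrid G fun v => ?_))
  rw [div_le_iff₀ (half_pos hε)] at hlarge
  push_cast
  linarith [hdeg v]

end upperBound

end TwoColoredGraph

theorem lemma3p1 {V : Type*} [Finite V] (H : TwoColoredGraph V)
    (hH : ∃ u v : V, H.red.Adj u v ∨ H.blue.Adj u v) :
    Filter.Tendsto H.turanDensityAt Filter.atTop (nhds H.turanDensity) ∧
      (¬ H.IsBipartite → 3 / 2 ≤ H.turanDensity) ∧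
      (H.IsBipartite → H.turanDensity ≤ 3 / 2) :=
  ⟨H.tendsto_turanDensityAt, TwoColoredGraph.three_halves_le_turanDensity,
    TwoColoredGraph.IsBipartite.turanDensity_le⟩
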